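/- Let $p\ge 2$ and $r\ge 2$ be integers, let $\mu\neq\lambda$ be nonzero complex numbers, and let $A$ be a complex $d\times d$ matrix such that $P(A)=0$, where $P(z)=(z-\mu)(z-\lambda)^{r-1}=z^r-a_0z^{r-1}-\cdots-a_{r-1}$. Put $A_0=I$ and $A_{s}=A\,A_{s-1}-a_{s-1}I$ for $1\le s\le r-1$. Define $$C_\mu=\frac{\mu^{r-1}}{(\mu-\lambda)^{r-1}},\qquad C_{\lambda,j}=-\sum_{h=j}^{r-2}\frac{\lambda^{r-1-h}}{(\mu-\lambda)^{r-1-h}}\sum_{k=j}^{h}\binom{r-1}{h-k}\frac{S(k,j)}{k!}\quad(0\le j\le r-2),$$ where $S(k,j)$ are the signed Stirling numbers of the first kind, $x(x-1)\cdots(x-k+1)=\sum_j S(k,j)x^j$. Let $D=t\frac{d}{dt}$ with $D^0$ the identity, and take principal branches of the powers $(1-\mu t)^{1/p}$ and $(1-\lambda t)^{1/p}$ as functions of the real variable $t$. Let $t\ne 0$ be a real number with $|t|\rho(A)<1$, where $\rho(A)$ is the spectral radius. Then $$(I-tA)^{1/p}=\sum_{s=0}^{r-1}\varphi_s(t)A_s,$$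 where $$\varphi_0(t)=C_\mu(1-\mu t)^{1/p}+\sum_{j=0}^{r-2}C_{\lambda,j}D^j(1-\lambda t)^{1/p},$$ and, for $1\le s\le r-1$, $$\varphi_s(t)=\frac{C_\mu}{\mu^s}(1-\mu t)^{1/p}+\sum_{j=0}^{r-2}\sum_{k=0}^{j}\frac{C_{\lambda,j}}{\lambda^s}\binom jk(-s)^{j-k}D^k(1-\lambda t)^{1/p}.$$ Here $(I-tA)^{1/p}$ is the principal $p$th root, that is, the unique matrix $X$ with $X^p=I-tA$ all of whose eigenvalues lie in $\{z\ne0:|\arg z|<\pi/p\}$; it equals the sum of the convergent series $\sum_{n\ge0}b_nt^nA^n$, where $b_n=\frac{(-1)^n}{n!}\prod_{i=0}^{n-1}\left(\frac1p-i\right)$. If $\lambda t\ne1$, then $(1-\lambda t)^{1/p}$ is a smooth function of the real variable near $t$, so the terms $D^k(1-\lambda t)^{1/p}$ are classical. The case $\lambda t=1$ can occur only if $\lambda$ is not an eigenvalue of $A$; then a derivative that does not exist is read as $0$. -/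

import Mathlib

open Polynomial
open scoped ContDiff

namespace MatrixRoot

noncomputable section

/-- The coefficients `a₀, a₁, …` of a monic polynomial written as
`P(z) = z ^ r - a₀ z ^ (r - 1) - ⋯ - a_{r-1}`, where `r` is the degree of `P`. -/
def fibCoeff (P : ℂ[X]) (j : ℕ) : ℂ := -P.coeff (P.natDegree - 1 - j)

/-- The Hörner polynomials of `P`: `P₀ = 1` and `P_{j+1}(z) = z P_j(z) - a_j`. -/
def hornerPoly (P : ℂ[X]) : ℕ → ℂ[X]
  | 0 => 1
  | j + 1 => X * hornerPoly P j - C (fibCoeff P j)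

/-- The Fibonacci-Hörner system `A_s = P_s(A)` of a matrix `A` relative to `P`. -/
def hornerMatrix {d : ℕ} (P : ℂ[X]) (A : Matrix (Fin d) (Fin d) ℂ) (s : ℕ) :
    Matrix (Fin d) (Fin d) ℂ :=
  aeval A (hornerPoly P s)

/-- `X` is a principal `p`-th root of `B`: `X ^ p = B` and every eigenvalue `z` of `X` satisfies
`z ≠ 0` and `|arg z| < π / p`. -/
def IsPrincipalRoot {d : ℕ} (p : ℕ) (B X : Matrix (Fin d) (Fin d) ℂ) : Prop :=
  X ^ p = B ∧ ∀ z ∈ spectrum ℂ X, z ≠ 0 ∧ |Complex.arg z| < Real.pi / p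

/-- The Taylor coefficients `b_n` of `(1 - z) ^ (1 / p) = ∑ b_n z ^ n`, that is
`b_n = (-1) ^ n (1/p) (1/p - 1) ⋯ (1/p - n + 1) / n!`. -/
def taylorCoeff (p n : ℕ) : ℂ :=
  (-1) ^ n * (∏ i ∈ Finset.range n, ((1 : ℂ) / p - i)) / n.factorial

/-- The signed Stirling numbers of the first kind:
`x (x - 1) ⋯ (x - k + 1) = ∑ j, S(k, j) x ^ j`. -/
def stirlingSigned (k j : ℕ) : ℤ := (descPochhammer ℤ k).coeff j

/-- The numbers `γ_h` (`0 ≤ h < m`) attached to the root `x` of multiplicity `m` of the polynomial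
`(z - x) ^ m (z - y) ^ q`, where `q ≥ 1` and `y ≠ x`: with `n = m - h - 1`,
`γ_h = (-1) ^ q * binom (n + q - 1) n / (y - x) ^ (n + q)`. -/
def gammaCoeff (x : ℂ) (m : ℕ) (y : ℂ) (q h : ℕ) : ℂ :=
  (-1) ^ q * ((m - h - 1 + q - 1).choose (m - h - 1) : ℂ) / (y - x) ^ (m - h - 1 + q)

/-- The coefficient of `n ^ j x ^ n` (`0 ≤ j < m`) in the Binet formula of the sequence
`u_{n+1} = a₀ u_n + ⋯ + a_{r-1} u_{n-r+1}`, `u_0 = 1`, `u_n = 0` for `n < 0`,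
whose characteristic polynomial is `(z - x) ^ m (z - y) ^ q`, of degree `r = m + q`. -/
def binetCoeff (x : ℂ) (m : ℕ) (y : ℂ) (q j : ℕ) : ℂ :=
  ∑ h ∈ Finset.Icc j (m - 1), x ^ (m + q - 1 - h) * gammaCoeff x m y q h *
    ∑ k ∈ Finset.Icc j h,
      ((m + q - 1).choose (h - k) : ℂ) * (stirlingSigned k j : ℂ) / (k.factorial : ℂ)

/-- The operator `D = t d/dt` on functions of a real variable `t`. -/
def degreeOp (f : ℝ → ℂ) : ℝ → ℂ := fun t => (t : ℂ) * deriv f t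

/-- The function `t ↦ (1 - x t) ^ (1 / p)` (principal branch). -/
def rootFun (p : ℕ) (x : ℂ) : ℝ → ℂ := fun t => (1 - x * (t : ℂ)) ^ ((1 : ℂ) / (p : ℂ))

/-- The functions `φ_s` for the annihilating polynomial `(z - μ) (z - lam) ^ (r - 1)`. -/
def phi (p r : ℕ) (μ lam : ℂ) (s : ℕ) (t : ℝ) : ℂ :=
  let Cμ : ℂ := binetCoeff μ 1 lam (r - 1) 0
  let Clam : ℕ → ℂ := fun j => binetCoeff lam (r - 1) μ 1 j
  if s = 0 then
    Cμ * rootFun p μ t + ∑ j ∈ Finset.range (r - 1), Clam j * degreeOp^[j] (rootFun p lam) t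
  else
    Cμ / μ ^ s * rootFun p μ t +
      ∑ j ∈ Finset.range (r - 1), ∑ k ∈ Finset.range (j + 1),
        Clam j / lam ^ s * (-(s : ℂ)) ^ (j - k) * (j.choose k : ℂ) *
          degreeOp^[k] (rootFun p lam) t

end

end MatrixRoot

namespace MatrixRoot

/-! ### Hörner polynomials -/

/-! In the Hörner basis, `A ^ n` has coordinates `L (X ^ (n + m - s))`, where `m = r - 1` and `L` is
the linear form killing the multiples of `P` with values `0, …, 0, 1` on `1, …, X ^ m`
(`pow_eq_sum_hornerPoly`). This `L` is the divided difference with node `μ` once and `λ` `m` times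
(`taylorRemainder`); evaluating it on powers yields the Binet formula. Hence `A ^ n = μ ^ n E + ∑ n
^ k λ ^ n N_k` (`pow_eq_components`), and the `φ_s` combine to the same `E` and `N_k`
(`sum_phi_smul`). Since `D ^ k` multiplies the `n`-th term of the binomial series by `n ^ k`,
summing against `b_n t ^ n` gives `hasSum_sum_phi_smul`. A component belonging to a non-eigenvalue
is zero, so divergence or missing derivatives there do no harm.

The `p`-th power of the sum is `1 - tA` because this holds for formal power series. The same
summation in the algebra `ℂ` places the eigenvalues in the sector. For uniqueness, another principal
root `Y` has `A`, hence the sum, as a polynomial in `Y`; factoring a difference of `p`-th powers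
then identifies the two (`aeval_eq_self_of_pow_eq`). -/

theorem coeff_iterate_divX {R : Type*} [Semiring R] (P : R[X]) (m n : ℕ) :
    (divX^[m] P).coeff n = P.coeff (m + n) := by
  induction m generalizing n with
  | zero => simp
  | succ m ih => rw [Function.iterate_succ_apply', coeff_divX, ih]; congr 1; omega

theorem X_mul_iterate_divX_add {R : Type*} [Semiring R] (P : R[X]) (m : ℕ) :
    X * divX^[m + 1] P + C (P.coeff m) = divX^[m] P := by
  rw [Function.iterate_succ_apply']
  conv_rhs => rw [← X_mul_divX_add (divX^[m] P)]
  rw [coeff_iterate_divX, add_zero]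

/-- Each Hörner step restores the coefficient that one `divX` drops; after `deg P` steps nothing is
missing and `P` itself is recovered. -/
theorem hornerPoly_eq_iterate_divX {P : ℂ[X]} (hP : P.Monic) {s : ℕ} (hs : s ≤ P.natDegree) :
    hornerPoly P s = divX^[P.natDegree - s] P := by
  induction s with
  | zero =>
    ext n
    rw [coeff_iterate_divX, hornerPoly, coeff_one]
    rcases n with _ | n
    · simpa using hP.coeff_natDegree.symm
    · rw [coeff_eq_zero_of_natDegree_lt (by omega)]; simp
  | succ s ih =>
    rw [hornerPoly, ih (by omega), fibCoeff, C_neg, sub_neg_eq_add]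
    have h := X_mul_iterate_divX_add P (P.natDegree - (s + 1))
    rw [show P.natDegree - (s + 1) + 1 = P.natDegree - s by omega] at h
    rw [show P.natDegree - 1 - s = P.natDegree - (s + 1) by omega, h]

theorem hornerPoly_natDegree {P : ℂ[X]} (hP : P.Monic) : hornerPoly P P.natDegree = P := by
  simp [hornerPoly_eq_iterate_divX hP le_rfl]

/-- A linear form on polynomials that vanishes on the multiples of `P` and takes the values
`0, …, 0, 1` on `1, X, …, X ^ (deg P - 1)` gives the coordinates of powers in the Hörner basis. -/
theorem pow_eq_sum_hornerPoly {𝒜 : Type*} [Ring 𝒜] [Algebra ℂ 𝒜] {P : ℂ[X]} {m : ℕ}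
    (hP : P.Monic) (hdeg : P.natDegree = m + 1) (L : ℂ[X] →ₗ[ℂ] ℂ)
    (hL : ∀ q, L (q * P) = 0) (hL0 : ∀ i < m, L (X ^ i) = 0) (hL1 : L (X ^ m) = 1)
    {a : 𝒜} (ha : aeval a P = 0) (n : ℕ) :
    a ^ n = ∑ s ∈ Finset.range (m + 1), L (X ^ (n + m - s)) • aeval a (hornerPoly P s) := by
  induction n with
  | zero =>
    rw [Finset.sum_eq_single 0]
    · simp [hL1, hornerPoly]
    · intro s hs hs0
      rw [Finset.mem_range] at hs
      rw [hL0 _ (by omega), zero_smul]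
    · simp
  | succ n ih =>
    have hstep : ∀ s, a * aeval a (hornerPoly P s) =
        aeval a (hornerPoly P (s + 1)) + fibCoeff P s • 1 := by
      intro s
      simp [hornerPoly, Algebra.algebraMap_eq_smul_one]
    -- The recurrence is `L (X ^ n * P) = 0` written out.
    have hrec : L (X ^ (n + 1 + m)) =
        ∑ s ∈ Finset.range (m + 1), L (X ^ (n + m - s)) * fibCoeff P s := by
      have h := hL (X ^ n)
      have hPs : P = X ^ (m + 1) + ∑ s ∈ Finset.range (m + 1), C (-fibCoeff P s) * X ^ (m - s) := by
        conv_lhs => rw [hP.as_sum, hdeg, ← Finset.sum_range_reflect]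
        congr 1
        refine Finset.sum_congr rfl fun s _ => ?_
        rw [fibCoeff, hdeg, neg_neg]
        simp
      rw [hPs, mul_add, map_add, ← pow_add, Finset.mul_sum, map_sum] at h
      rw [show n + 1 + m = n + (m + 1) by omega, eq_neg_of_add_eq_zero_left h,
        ← Finset.sum_neg_distrib]
      refine Finset.sum_congr rfl fun s hs => ?_
      rw [Finset.mem_range] at hs
      rw [show (X : ℂ[X]) ^ n * (C (-fibCoeff P s) * X ^ (m - s)) =
        (-fibCoeff P s) • X ^ (n + m - s) by
          rw [smul_eq_C_mul, show n + m - s = n + (m - s) by omega, pow_add]; ring]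
      rw [map_smul, smul_eq_mul]; ring
    rw [pow_succ', ih, Finset.mul_sum]
    simp_rw [mul_smul_comm, hstep, smul_add, smul_smul]
    -- Multiplication by `a` shifts the basis; the multiples of `1` it leaves collect into the new
    -- coordinate at `s = 0`, and the top term is `P(a) = 0`.
    rw [Finset.sum_add_distrib, ← Finset.sum_smul, ← hrec, Finset.sum_range_succ,
      Finset.sum_range_succ']
    have hlast : aeval a (hornerPoly P (m + 1)) = 0 := by
      rw [← hdeg, hornerPoly_natDegree hP, ha]
    rw [hlast, smul_zero, add_zero]
    simp only [hornerPoly, map_one, Nat.sub_zero]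
    congr 1
    refine Finset.sum_congr rfl fun s _ => ?_
    congr 3
    omega

/-- The linear form `q ↦ (q(x) - T(x)) / (x - y) ^ m`, where `T` is the Taylor polynomial of `q`
of degree `< m` at `y`. -/
noncomputable def taylorRemainder (x y : ℂ) (m : ℕ) : ℂ[X] →ₗ[ℂ] ℂ :=
  ((x - y) ^ m)⁻¹ • (Polynomial.leval x -
    ∑ h ∈ Finset.range m, ((x - y) ^ h) • (Polynomial.lcoeff ℂ h ∘ₗ taylor y))

theorem taylorRemainder_apply (x y : ℂ) (m : ℕ) (q : ℂ[X]) :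
    taylorRemainder x y m q = ((x - y) ^ m)⁻¹ *
      (q.eval x - ∑ h ∈ Finset.range m, (x - y) ^ h * (taylor y q).coeff h) := by
  simp [taylorRemainder]

theorem taylorRemainder_mul (x y : ℂ) (m : ℕ) (q : ℂ[X]) :
    taylorRemainder x y m (q * ((X - C x) * (X - C y) ^ m)) = 0 := by
  rw [taylorRemainder_apply, Finset.sum_eq_zero]
  · simp
  · intro h hh
    rw [Finset.mem_range] at hh
    rw [show q * ((X - C x) * (X - C y) ^ m) = (X - C y) ^ m * (q * (X - C x)) by ring,
      taylor_mul, taylor_pow]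
    simp only [map_sub, taylor_X, taylor_C, add_sub_cancel_right]
    rw [coeff_X_pow_mul', if_neg (by omega), mul_zero]

theorem eval_eq_sum_taylor_coeff (x y : ℂ) (q : ℂ[X]) {N : ℕ} (hN : q.natDegree < N) :
    q.eval x = ∑ h ∈ Finset.range N, (x - y) ^ h * (taylor y q).coeff h := by
  rw [← taylor_eval_sub y q x, eval_eq_sum_range' (n := N) (by rwa [natDegree_taylor])]
  exact Finset.sum_congr rfl fun _ _ => mul_comm _ _

theorem taylorRemainder_X_pow_of_lt (x y : ℂ) {m i : ℕ} (hi : i < m) :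
    taylorRemainder x y m (X ^ i) = 0 := by
  rw [taylorRemainder_apply, ← eval_eq_sum_taylor_coeff x y _ (by simpa using hi), sub_self,
    mul_zero]

theorem taylorRemainder_X_pow_self {x y : ℂ} (hxy : x ≠ y) (m : ℕ) :
    taylorRemainder x y m (X ^ m) = 1 := by
  have h := eval_eq_sum_taylor_coeff x y (X ^ m) (N := m + 1) (by simp)
  have hc : (taylor y (X ^ m : ℂ[X])).coeff m = 1 := by
    have := coeff_taylor_natDegree (r := y) (f := (X ^ m : ℂ[X]))
    simpa using this
  rw [Finset.sum_range_succ, hc] at h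
  rw [taylorRemainder_apply, h]
  have : (x - y) ^ m ≠ 0 := pow_ne_zero _ (sub_ne_zero.2 hxy)
  field_simp
  ring

theorem taylor_X_pow_coeff (y : ℂ) (i h : ℕ) :
    (taylor y (X ^ i : ℂ[X])).coeff h = y ^ (i - h) * i.choose h := by
  rw [taylor_pow, taylor_X, coeff_X_add_C_pow]

/-! ### The Binet formula -/

theorem sum_stirlingSigned_mul_pow (x : ℂ) {k N : ℕ} (hN : k < N) :
    ∑ j ∈ Finset.range N, (stirlingSigned k j : ℂ) * x ^ j = k.factorial * Ring.choose x k := by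
  have h := Ring.descPochhammer_eq_factorial_smul_choose x k
  rw [nsmul_eq_mul] at h
  rw [← h, smeval_eq_sum, Polynomial.sum_over_range' _
    (fun n => by rw [Polynomial.smul_pow, zero_smul]) N (by rwa [descPochhammer_natDegree])]
  simp [stirlingSigned, Polynomial.smul_pow]

/-- The Stirling numbers expand `Ring.choose z k` in powers of `z`, and the sum over `k` is
Vandermonde's convolution for `Ring.choose (z + m) h`. -/
theorem sum_binetCoeff_mul_pow (x y : ℂ) {m : ℕ} (hm : 1 ≤ m) (z : ℂ) :
    ∑ j ∈ Finset.range m, binetCoeff y m x 1 j * z ^ j =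
      -∑ h ∈ Finset.range m, y ^ (m - h) / (x - y) ^ (m - h) * Ring.choose (z + m) h := by
  have hvan : ∀ h, Ring.choose (z + m) h =
      ∑ k ∈ Finset.range (h + 1), (m.choose (h - k) : ℂ) * Ring.choose z k := by
    intro h
    rw [Ring.add_choose_eq h (Commute.all z (m : ℂ)),
      Finset.Nat.sum_antidiagonal_eq_sum_range_succ (fun i j => Ring.choose z i * Ring.choose (m : ℂ) j)]
    refine Finset.sum_congr rfl fun k _ => ?_
    rw [Ring.choose_natCast, mul_comm]
  have hz : ∀ k j, k < j → stirlingSigned k j = 0 := by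
    intro k j hkj
    exact coeff_eq_zero_of_natDegree_lt (by rwa [descPochhammer_natDegree])
  have hb : ∀ j ∈ Finset.range m, binetCoeff y m x 1 j =
      ∑ h ∈ Finset.range m, -(y ^ (m - h) / (x - y) ^ (m - h)) *
        ∑ k ∈ Finset.range (h + 1), (m.choose (h - k) : ℂ) * stirlingSigned k j / k.factorial := by
    intro j _
    rw [binetCoeff]
    have h1 : ∀ h, ∑ k ∈ Finset.range (h + 1),
        (m.choose (h - k) : ℂ) * stirlingSigned k j / k.factorial =
        ∑ k ∈ Finset.Icc j h, (m.choose (h - k) : ℂ) * stirlingSigned k j / k.factorial := by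
      intro h
      symm
      apply Finset.sum_subset
      · intro k; simp only [Finset.mem_Icc, Finset.mem_range]; omega
      · intro k hk hk'
        simp only [Finset.mem_Icc, Finset.mem_range] at hk hk'
        rw [hz k j (by omega)]; simp
    simp_rw [h1]
    have h2 : Finset.Icc j (m - 1) ⊆ Finset.range m := by
      intro k; simp only [Finset.mem_Icc, Finset.mem_range]; omega
    rw [← Finset.sum_subset h2]
    · refine Finset.sum_congr rfl fun h hh => ?_
      rw [Finset.mem_Icc] at hh
      rw [gammaCoeff, show m + 1 - 1 = m by omega, show m - h - 1 + 1 = m - h by omega]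
      simp
      ring
    · intro h hh hh'
      simp only [Finset.mem_Icc, Finset.mem_range] at hh hh'
      rw [Finset.Icc_eq_empty (by omega)]; simp
  rw [Finset.sum_congr rfl fun j hj => by rw [hb j hj]]
  simp_rw [Finset.sum_mul]
  rw [Finset.sum_comm, ← Finset.sum_neg_distrib]
  refine Finset.sum_congr rfl fun h hh => ?_
  rw [Finset.mem_range] at hh
  simp_rw [mul_assoc]
  rw [← Finset.mul_sum, hvan, neg_mul]
  congr 2
  simp_rw [Finset.sum_mul]
  rw [Finset.sum_comm]
  refine Finset.sum_congr rfl fun k hk => ?_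
  rw [Finset.mem_range] at hk
  have hf : (k.factorial : ℂ) ≠ 0 := Nat.cast_ne_zero.2 k.factorial_ne_zero
  rw [← mul_div_cancel_left₀ (Ring.choose z k) hf, ← sum_stirlingSigned_mul_pow z (N := m) (by omega),
    Finset.sum_div, Finset.mul_sum]
  refine Finset.sum_congr rfl fun j _ => ?_
  ring

theorem binetCoeff_simple (x y : ℂ) (m : ℕ) :
    binetCoeff x 1 y m 0 = x ^ m / (x - y) ^ m := by
  have : (y - x) ^ m = (-1) ^ m * (x - y) ^ m := by rw [← mul_pow]; ring
  simp [binetCoeff, gammaCoeff, stirlingSigned, this]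
  rcases Nat.even_or_odd m with h | h <;> simp [h.neg_one_pow] <;> ring

/-- The value at `x` gives the simple-root term; the Taylor coefficients at `y` are binomials in `n
+ m - s`, that is, polynomials in `n - s`. -/
theorem taylorRemainder_X_pow_eq_binet {x y : ℂ} (hx : x ≠ 0) (hy : y ≠ 0) (hxy : x ≠ y) {m : ℕ}
    (hm : 1 ≤ m) (n : ℕ) {s : ℕ} (hs : s ≤ m) :
    taylorRemainder x y m (X ^ (n + m - s)) = binetCoeff x 1 y m 0 / x ^ s * x ^ n +
      (∑ j ∈ Finset.range m, binetCoeff y m x 1 j * ((n : ℂ) - s) ^ j) / y ^ s * y ^ n := by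
  have hd : x - y ≠ 0 := sub_ne_zero.2 hxy
  rw [taylorRemainder_apply, sum_binetCoeff_mul_pow x y hm, binetCoeff_simple, mul_sub,
    sub_eq_add_neg]
  congr 1
  · have : x ^ (n + m - s) * x ^ s = x ^ n * x ^ m := by rw [← pow_add, ← pow_add]; congr 1; omega
    rw [eval_pow, eval_X]
    field_simp
    linear_combination this
  · rw [neg_div, neg_mul, neg_inj, Finset.mul_sum, Finset.sum_div, Finset.sum_mul]
    refine Finset.sum_congr rfl fun h hh => ?_
    rw [Finset.mem_range] at hh
    rw [taylor_X_pow_coeff, show (n : ℂ) - s + m = ((n + m - s : ℕ) : ℂ) by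
      rw [Nat.cast_sub (by omega)]; push_cast; ring, Ring.choose_natCast]
    by_cases hc : h ≤ n + m - s
    · have h1 : y ^ (n + m - s - h) * y ^ s = y ^ (m - h) * y ^ n := by
        rw [← pow_add, ← pow_add]; congr 1; omega
      have h2 : (x - y) ^ m = (x - y) ^ (m - h) * (x - y) ^ h := by
        rw [← pow_add]; congr 1; omega
      rw [h2]
      field_simp
      linear_combination ((n + m - s).choose h : ℂ) * h1
    -- Here the exponent is truncated to zero, but the binomial coefficient vanishes as well.
    · rw [Nat.choose_eq_zero_of_lt (by omega)]; simp

/-! ### Powers of an algebra element annihilated by `(z - μ) (z - λ) ^ m` -/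

section Algebra

variable {𝒜 : Type*} [Ring 𝒜] [Algebra ℂ 𝒜]

/-- The coefficient of `μ ^ n` in the powers of `a`. -/
noncomputable def simpleComponent (P : ℂ[X]) (m : ℕ) (μ lam : ℂ) (a : 𝒜) : 𝒜 :=
  ∑ s ∈ Finset.range (m + 1), (binetCoeff μ 1 lam m 0 / μ ^ s) • aeval a (hornerPoly P s)

/-- The coefficient of `n ^ k * lam ^ n` in the powers of `a`. -/
noncomputable def multipleComponent (P : ℂ[X]) (m : ℕ) (μ lam : ℂ) (a : 𝒜) (k : ℕ) : 𝒜 :=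
  ∑ s ∈ Finset.range (m + 1), (∑ j ∈ Finset.range m,
    binetCoeff lam m μ 1 j / lam ^ s * (-(s : ℂ)) ^ (j - k) * (j.choose k : ℂ)) •
      aeval a (hornerPoly P s)

variable {P : ℂ[X]} {m : ℕ} {μ lam : ℂ}

theorem monic_of_eq (hP : P = (X - C μ) * (X - C lam) ^ m) : P.Monic := by
  rw [hP]; exact (monic_X_sub_C μ).mul ((monic_X_sub_C lam).pow m)

theorem natDegree_of_eq (hP : P = (X - C μ) * (X - C lam) ^ m) : P.natDegree = m + 1 := by
  rw [hP, (monic_X_sub_C μ).natDegree_mul ((monic_X_sub_C lam).pow m),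
    (monic_X_sub_C lam).natDegree_pow]
  simp [add_comm]

theorem pow_eq_components (hP : P = (X - C μ) * (X - C lam) ^ m) (hm : 1 ≤ m) (hμ : μ ≠ 0)
    (hlam : lam ≠ 0) (hne : μ ≠ lam) {a : 𝒜} (ha : aeval a P = 0) (n : ℕ) :
    a ^ n = μ ^ n • simpleComponent P m μ lam a +
      ∑ k ∈ Finset.range m, ((n : ℂ) ^ k * lam ^ n) • multipleComponent P m μ lam a k := by
  rw [pow_eq_sum_hornerPoly (monic_of_eq hP) (natDegree_of_eq hP) (taylorRemainder μ lam m)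
    (fun q => by rw [hP, taylorRemainder_mul]) (fun i hi => taylorRemainder_X_pow_of_lt μ lam hi)
    (taylorRemainder_X_pow_self hne m) ha n]
  simp only [simpleComponent, multipleComponent, Finset.smul_sum]
  rw [Finset.sum_comm (s := Finset.range m), ← Finset.sum_add_distrib]
  refine Finset.sum_congr rfl fun s hs => ?_
  rw [Finset.mem_range] at hs
  simp_rw [smul_smul]
  rw [← Finset.sum_smul, ← add_smul,
    taylorRemainder_X_pow_eq_binet hμ hlam hne hm n (by omega : s ≤ m)]
  congr 1
  congr 1
  · ring
  · simp_rw [Finset.mul_sum]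
    rw [Finset.sum_comm, Finset.sum_div, Finset.sum_mul]
    refine Finset.sum_congr rfl fun j hj => ?_
    rw [Finset.mem_range] at hj
    have hbin : ((n : ℂ) - s) ^ j =
        ∑ k ∈ Finset.range m, (n : ℂ) ^ k * (-(s : ℂ)) ^ (j - k) * (j.choose k : ℂ) := by
      rw [sub_eq_add_neg, add_pow]
      apply Finset.sum_subset
      · intro k; simp only [Finset.mem_range]; omega
      · intro k hk hk'
        simp only [Finset.mem_range] at hk hk'
        rw [Nat.choose_eq_zero_of_lt (by omega)]; simp
    rw [hbin, Finset.mul_sum, Finset.sum_div, Finset.sum_mul]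
    refine Finset.sum_congr rfl fun k _ => ?_
    ring

theorem sum_phi_smul (p : ℕ) (t : ℝ) (a : 𝒜) :
    ∑ s ∈ Finset.range (m + 1), phi p (m + 1) μ lam s t • aeval a (hornerPoly P s) =
      rootFun p μ t • simpleComponent P m μ lam a +
      ∑ k ∈ Finset.range m, degreeOp^[k] (rootFun p lam) t • multipleComponent P m μ lam a k := by
  simp only [simpleComponent, multipleComponent, Finset.smul_sum]
  rw [Finset.sum_comm (s := Finset.range m), ← Finset.sum_add_distrib]
  refine Finset.sum_congr rfl fun s hs => ?_
  simp_rw [smul_smul]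
  rw [← Finset.sum_smul, ← add_smul]
  congr 1
  simp_rw [Finset.mul_sum]
  rw [Finset.sum_comm]
  have hext : ∀ j ∈ Finset.range m, ∑ k ∈ Finset.range m, degreeOp^[k] (rootFun p lam) t *
      (binetCoeff lam m μ 1 j / lam ^ s * (-(s : ℂ)) ^ (j - k) * (j.choose k : ℂ)) =
      ∑ k ∈ Finset.range (j + 1), binetCoeff lam m μ 1 j / lam ^ s * (-(s : ℂ)) ^ (j - k) *
        (j.choose k : ℂ) * degreeOp^[k] (rootFun p lam) t := by
    intro j hj
    rw [Finset.mem_range] at hj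
    symm
    rw [Finset.sum_subset (s₂ := Finset.range m)]
    · exact Finset.sum_congr rfl fun k _ => by ring
    · intro k; simp only [Finset.mem_range]; omega
    · intro k hk hk'
      simp only [Finset.mem_range] at hk hk'
      rw [Nat.choose_eq_zero_of_lt (by omega)]; simp
  rw [Finset.sum_congr rfl hext]
  simp only [phi, Nat.add_sub_cancel]
  split_ifs with h0
  · subst h0
    congr 1
    · simp [mul_comm]
    · refine Finset.sum_congr rfl fun j _ => ?_
      -- At `s = 0` only `k = j` survives, since `0 ^ (j - k) = 0` otherwise.
      rw [Finset.sum_range_succ, Finset.sum_eq_zero]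
      · simp
      · intro k hk
        rw [Finset.mem_range] at hk
        rw [Nat.cast_zero, neg_zero, zero_pow (by omega)]; simp
  · congr 1
    ring

/-! ### Vanishing of the components at points outside the spectrum. -/

theorem X_sub_C_mul_sum_hornerPoly (P : ℂ[X]) (x : ℂ) (N : ℕ) :
    (X - C x) * ∑ s ∈ Finset.range N, C (x ^ (N - 1 - s)) * hornerPoly P s =
      hornerPoly P N - C (x ^ N - ∑ s ∈ Finset.range N, x ^ (N - 1 - s) * fibCoeff P s) := by
  induction N with
  | zero => simp [hornerPoly]
  | succ N ih =>
    have hshift : ∀ s ∈ Finset.range N, x ^ (N + 1 - 1 - s) = x * x ^ (N - 1 - s) := by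
      intro s hs
      rw [Finset.mem_range] at hs
      rw [← pow_succ']; congr 1; omega
    have h1 : ∑ s ∈ Finset.range N, C (x ^ (N + 1 - 1 - s)) * hornerPoly P s =
        C x * ∑ s ∈ Finset.range N, C (x ^ (N - 1 - s)) * hornerPoly P s := by
      rw [Finset.mul_sum]
      exact Finset.sum_congr rfl fun s hs => by rw [hshift s hs, C_mul, mul_assoc]
    have h2 : ∑ s ∈ Finset.range N, x ^ (N + 1 - 1 - s) * fibCoeff P s =
        x * ∑ s ∈ Finset.range N, x ^ (N - 1 - s) * fibCoeff P s := by
      rw [Finset.mul_sum]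
      exact Finset.sum_congr rfl fun s hs => by rw [hshift s hs, mul_assoc]
    rw [Finset.sum_range_succ, Finset.sum_range_succ, h1, h2, mul_add, mul_left_comm, ih]
    simp only [hornerPoly, map_sub, map_mul, map_add, map_pow, Nat.add_sub_cancel, Nat.sub_self,
      pow_zero, one_mul, map_one]
    ring

theorem sum_hornerPoly_eq_pow (hP : P = (X - C μ) * (X - C lam) ^ m) :
    ∑ s ∈ Finset.range (m + 1), C (μ ^ (m - s)) * hornerPoly P s = (X - C lam) ^ m := by
  have h := X_sub_C_mul_sum_hornerPoly P μ (m + 1)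
  have hN : hornerPoly P (m + 1) = P := by
    rw [← natDegree_of_eq hP, hornerPoly_natDegree (monic_of_eq hP)]
  -- Evaluation at the root `μ` shows that the remainder of the synthetic division is zero.
  have h0 := congrArg (eval μ) h
  rw [hN, eval_sub, eval_C, eval_mul, eval_sub, eval_X, eval_C, sub_self, zero_mul,
    hP, eval_mul, eval_sub, eval_X, eval_C, sub_self, zero_mul, ← hP, zero_sub, eq_comm,
    neg_eq_zero] at h0
  rw [hN, h0, C_0, sub_zero] at h
  refine mul_left_cancel₀ (X_sub_C_ne_zero μ) ?_
  rw [← hP]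
  exact h

theorem simpleComponent_eq_pow (hP : P = (X - C μ) * (X - C lam) ^ m) (hμ : μ ≠ 0) (a : 𝒜) :
    simpleComponent P m μ lam a = ((μ - lam) ^ m)⁻¹ • (a - algebraMap ℂ 𝒜 lam) ^ m := by
  have h := congrArg (aeval a) (sum_hornerPoly_eq_pow hP)
  rw [map_sum, map_pow, map_sub, aeval_X, aeval_C] at h
  rw [← h, simpleComponent, Finset.smul_sum]
  refine Finset.sum_congr rfl fun s hs => ?_
  rw [Finset.mem_range] at hs
  rw [map_mul, aeval_C, ← Algebra.smul_def, smul_smul, binetCoeff_simple]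
  congr 1
  have : μ ^ m = μ ^ (m - s) * μ ^ s := by rw [← pow_add]; congr 1; omega
  rw [this]
  field_simp

theorem isUnit_sub_algebraMap {x : ℂ} {a : 𝒜} (hx : x ∉ spectrum ℂ a) :
    IsUnit (a - algebraMap ℂ 𝒜 x) := by
  rw [← neg_sub, IsUnit.neg_iff]
  exact spectrum.notMem_iff.1 hx

theorem simpleComponent_eq_zero (hP : P = (X - C μ) * (X - C lam) ^ m) (hμ : μ ≠ 0)
    {a : 𝒜} (ha : aeval a P = 0) (hs : μ ∉ spectrum ℂ a) :
    simpleComponent P m μ lam a = 0 := by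
  rw [hP, map_mul, map_pow, map_sub, map_sub, aeval_X, aeval_C, aeval_C,
    (isUnit_sub_algebraMap hs).mul_right_eq_zero] at ha
  rw [simpleComponent_eq_pow hP hμ, ha, smul_zero]

/-- The nodes `0, …, m - 1` already suffice: their Vandermonde matrix is invertible. -/
theorem eq_zero_of_sum_pow_smul_eq_zero {M : Type*} [AddCommGroup M] [Module ℂ M] {m : ℕ}
    {N : ℕ → M} (h : ∀ n : ℕ, ∑ k ∈ Finset.range m, (n : ℂ) ^ k • N k = 0) {k : ℕ} (hk : k < m) :
    N k = 0 := by
  set V : Matrix (Fin m) (Fin m) ℂ := Matrix.vandermonde fun i : Fin m => (i : ℂ) with hV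
  have hdet : IsUnit V.det := by
    rw [isUnit_iff_ne_zero, hV, Matrix.det_vandermonde_ne_zero_iff]
    intro i j hij
    exact Fin.ext (Nat.cast_injective hij)
  have h1 : ∑ i, V⁻¹ ⟨k, hk⟩ i • ∑ j, V i j • N j = N k := by
    simp_rw [Finset.smul_sum, smul_smul]
    rw [Finset.sum_comm]
    simp_rw [← Finset.sum_smul, ← Matrix.mul_apply, Matrix.nonsing_inv_mul V hdet]
    simp [Matrix.one_apply, ite_smul]
  rw [← h1]
  refine Finset.sum_eq_zero fun i _ => ?_
  have := h i
  rw [Finset.sum_range] at this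
  simp only [hV, Matrix.vandermonde_apply, this, smul_zero]

/-- If `lam` is not an eigenvalue then `a = μ`, so the simple component alone produces all powers of
`a`. This makes the values of `degreeOp` irrelevant when `lam * t = 1`. -/
theorem multipleComponent_eq_zero (hP : P = (X - C μ) * (X - C lam) ^ m) (hm : 1 ≤ m) (hμ : μ ≠ 0)
    (hlam : lam ≠ 0) (hne : μ ≠ lam) {a : 𝒜} (ha : aeval a P = 0) (hs : lam ∉ spectrum ℂ a) {k : ℕ}
    (hk : k < m) : multipleComponent P m μ lam a k = 0 := by
  have hpow := pow_eq_components hP hm hμ hlam hne ha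
  have haμ : a = algebraMap ℂ 𝒜 μ := by
    have h := ha
    rw [hP, map_mul, map_pow, map_sub, map_sub, aeval_X, aeval_C, aeval_C,
      ((isUnit_sub_algebraMap hs).pow m).mul_left_eq_zero] at h
    exact sub_eq_zero.1 h
  have hE : simpleComponent P m μ lam a = 1 := by
    rw [simpleComponent_eq_pow hP hμ, haμ, ← map_sub, ← map_pow, Algebra.algebraMap_eq_smul_one,
      smul_smul, inv_mul_cancel₀ (pow_ne_zero _ (sub_ne_zero.2 hne)), one_smul]
  refine eq_zero_of_sum_pow_smul_eq_zero (m := m) (fun n => ?_) hk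
  have h := hpow n
  rw [hE, haμ, ← map_pow, Algebra.algebraMap_eq_smul_one, left_eq_add, ← haμ] at h
  simp_rw [mul_comm _ (lam ^ n), ← smul_smul] at h
  rw [← Finset.smul_sum] at h
  exact (smul_eq_zero_iff_right (pow_ne_zero n hlam)).1 h

end Algebra
/-! ### The binomial series -/

theorem taylorCoeff_eq_choose (p n : ℕ) :
    taylorCoeff p n = (-1) ^ n * Ring.choose ((1 : ℂ) / p) n := by
  have h : ∀ n, (descPochhammer ℤ n).smeval ((1 : ℂ) / p) =
      ∏ i ∈ Finset.range n, ((1 : ℂ) / p - i) := by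
    intro n
    induction n with
    | zero => simp
    | succ n ih =>
      rw [descPochhammer_succ_right, smeval_mul, ih, Finset.prod_range_succ]
      simp [smeval_sub, smeval_natCast]
  rw [taylorCoeff, Ring.choose_eq_smul, h, smul_eq_mul]
  ring

/-- The formal power series of `(1 - z) ^ (1 / p)`. -/
noncomputable def rootSeries (p : ℕ) : PowerSeries ℂ := PowerSeries.mk (taylorCoeff p)

/-- Binomial series multiply by adding exponents, and `p * (1 / p) = 1`. -/
theorem rootSeries_pow {p : ℕ} (hp : p ≠ 0) : rootSeries p ^ p = 1 - PowerSeries.X := by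
  have h : rootSeries p =
      PowerSeries.rescale (-1) (PowerSeries.binomialSeries ℂ ((1 : ℂ) / p)) := by
    ext n
    simp [rootSeries, taylorCoeff_eq_choose, PowerSeries.coeff_rescale]
  have hb : ∀ k : ℕ, PowerSeries.binomialSeries ℂ ((1 : ℂ) / p) ^ k =
      PowerSeries.binomialSeries ℂ ((k : ℂ) * (1 / p)) := by
    intro k
    induction k with
    | zero => simp
    | succ k ih => rw [pow_succ, ih, ← PowerSeries.binomialSeries_add]; congr 1; push_cast; ring
  have hp' : (p : ℂ) ≠ 0 := Nat.cast_ne_zero.2 hp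
  rw [h, ← map_pow, hb, mul_one_div_cancel hp', ← Nat.cast_one, PowerSeries.binomialSeries_nat]
  simp [sub_eq_add_neg]

theorem hasSum_taylorCoeff (p : ℕ) {z : ℂ} (hz : ‖z‖ < 1) :
    HasSum (fun n => taylorCoeff p n * z ^ n) ((1 - z) ^ ((1 : ℂ) / p)) := by
  have h := (Complex.one_add_cpow_hasFPowerSeriesOnBall_zero (a := (1 : ℂ) / p)).hasSum
    (y := -z) (by
      rw [← ENNReal.ofReal_one, Metric.eball_ofReal]; simpa using hz)
  rw [zero_add, ← sub_eq_add_neg] at h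
  refine h.congr_fun fun n => ?_
  rw [taylorCoeff_eq_choose, binomialSeries_apply]
  simp [neg_pow z]
  ring

theorem norm_taylorCoeff_le {p : ℕ} (hp : 1 ≤ p) (n : ℕ) : ‖taylorCoeff p n‖ ≤ 1 := by
  have hp' : (1 : ℝ) ≤ p := by exact_mod_cast hp
  have h1 : 0 ≤ 1 / (p : ℝ) ∧ 1 / (p : ℝ) ≤ 1 := ⟨by positivity, by
    rw [div_le_one (by linarith)]; exact hp'⟩
  rw [taylorCoeff, norm_div, norm_mul, norm_pow, norm_neg, norm_one, one_pow, one_mul,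
    Complex.norm_natCast, div_le_one (by exact_mod_cast n.factorial_pos)]
  induction n with
  | zero => simp
  | succ n ih =>
    rw [Finset.prod_range_succ, norm_mul, Nat.factorial_succ, mul_comm, Nat.cast_mul]
    -- Each factor satisfies `|1/p - n| ≤ n + 1`, the matching factor of the factorial.
    refine mul_le_mul ?_ ih (norm_nonneg _) (by positivity)
    rw [show (1 : ℂ) / p - n = ((1 / (p : ℝ) - n : ℝ) : ℂ) by push_cast; ring, Complex.norm_real,
      Real.norm_eq_abs, abs_le]
    push_cast
    have : (0 : ℝ) ≤ n := n.cast_nonneg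
    constructor <;> linarith [h1.1, h1.2]

theorem summable_taylorCoeff_mul_pow {p : ℕ} (hp : 1 ≤ p) (k : ℕ) {r : ℝ} (hr0 : 0 ≤ r)
    (hr : r < 1) : Summable fun n : ℕ => ‖taylorCoeff p n * (n : ℂ) ^ k‖ * r ^ n := by
  have h := summable_pow_mul_geometric_of_norm_lt_one k (r := r)
    (by rwa [Real.norm_eq_abs, abs_of_nonneg hr0])
  refine Summable.of_nonneg_of_le (fun n => by positivity) (fun n => ?_) h
  rw [norm_mul, norm_pow, Complex.norm_natCast]
  have : (0 : ℝ) ≤ (n : ℝ) ^ k * r ^ n := by positivity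
  nlinarith [norm_taylorCoeff_le hp n]

/-- A power series with absolutely summable coefficients on smaller discs may be differentiated
termwise; here in Euler form `z d/dz`. -/
theorem hasDerivAt_mul_of_hasSum {c : ℕ → ℂ} {f : ℂ → ℂ}
    (hc : ∀ r : ℝ, 0 ≤ r → r < 1 → Summable fun n => ‖c n * n‖ * r ^ n)
    (hf : ∀ z, ‖z‖ < 1 → HasSum (fun n => c n * z ^ n) (f z)) {z : ℂ} (hz : ‖z‖ < 1) :
    ∃ f', HasDerivAt f f' z ∧ HasSum (fun n => c n * n * z ^ n) (z * f') := by
  obtain ⟨R, hzR, hR⟩ := exists_between hz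
  have hR0 : 0 < R := (norm_nonneg z).trans_lt hzR
  -- The factor `R⁻¹` compensates for the exponent `n - 1` of the derivative.
  set u : ℕ → ℝ := fun n => ‖c n * n‖ * R ^ n * R⁻¹ with hu
  have hus : Summable u := (hc R hR0.le hR).mul_right _
  have hbound : ∀ n, ∀ y ∈ Metric.ball (0 : ℂ) R, ‖c n * (n * y ^ (n - 1))‖ ≤ u n := by
    intro n y hy
    rw [mem_ball_zero_iff] at hy
    rcases n with _ | n
    · simp [hu]
    · rw [← mul_assoc, norm_mul, hu]
      dsimp only
      rw [mul_assoc, pow_succ, mul_assoc (R ^ n), mul_inv_cancel₀ hR0.ne', mul_one, norm_pow,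
        Nat.add_sub_cancel]
      gcongr
  have hderiv : HasDerivAt (fun y => ∑' n, c n * y ^ n) (∑' n, c n * (n * z ^ (n - 1))) z :=
    hasDerivAt_tsum_of_isPreconnected hus Metric.isOpen_ball
      (convex_ball (0 : ℂ) R).isPreconnected
      (fun n y _ => (hasDerivAt_pow n y).const_mul (c n)) hbound
      (Metric.mem_ball_self hR0) (hf 0 (by simp)).summable (mem_ball_zero_iff.2 hzR)
  refine ⟨_, hderiv.congr_of_eventuallyEq ?_, ?_⟩
  · filter_upwards [Metric.isOpen_ball.mem_nhds (mem_ball_zero_iff.2 hz)] with y hy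
    exact (hf y (mem_ball_zero_iff.1 hy)).tsum_eq.symm
  · have hs : Summable fun n => c n * (n * z ^ (n - 1)) :=
      Summable.of_norm_bounded hus fun n => hbound n z (mem_ball_zero_iff.2 hzR)
    refine (hs.hasSum.mul_left z).congr_fun fun n => ?_
    rcases n with _ | n
    · simp
    · rw [Nat.add_sub_cancel, pow_succ]; ring

/-- One `f` serves all `t` at once: to differentiate again, the induction needs equality on a
neighbourhood. -/
theorem exists_hasSum_eulerSeries {p : ℕ} (hp : 1 ≤ p) (x : ℂ) (k : ℕ) :
    ∃ f : ℂ → ℂ, (∀ z, ‖z‖ < 1 → HasSum (fun n => taylorCoeff p n * (n : ℂ) ^ k * z ^ n) (f z)) ∧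
      ∀ t : ℝ, ‖x * t‖ < 1 → degreeOp^[k] (rootFun p x) t = f (x * t) := by
  induction k with
  | zero =>
    exact ⟨fun z => (1 - z) ^ ((1 : ℂ) / p),
      fun z hz => by simpa using hasSum_taylorCoeff p hz, fun t _ => rfl⟩
  | succ k ih =>
    obtain ⟨f, hf, hft⟩ := ih
    have hc : ∀ r : ℝ, 0 ≤ r → r < 1 →
        Summable fun n : ℕ => ‖taylorCoeff p n * (n : ℂ) ^ k * n‖ * r ^ n := by
      intro r hr0 hr
      simpa only [mul_assoc, ← pow_succ] using summable_taylorCoeff_mul_pow hp (k + 1) hr0 hr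
    have key := fun z (hz : ‖z‖ < 1) => hasDerivAt_mul_of_hasSum hc hf hz
    refine ⟨fun z => z * deriv f z, fun z hz => ?_, fun t ht => ?_⟩
    · obtain ⟨f', h1, h2⟩ := key z hz
      dsimp only
      rw [h1.deriv]
      simpa only [mul_assoc, ← pow_succ] using h2
    · obtain ⟨f', h1, -⟩ := key _ ht
      rw [Function.iterate_succ_apply', degreeOp]
      dsimp only
      rw [h1.deriv]
      have hlin : HasDerivAt (fun s : ℝ => x * (s : ℂ)) x t := by
        simpa using (Complex.ofRealCLM.hasDerivAt (x := t)).const_mul x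
      have hcomp : HasDerivAt (fun s : ℝ => f (x * s)) (f' * x) t := h1.comp t hlin
      have hev : degreeOp^[k] (rootFun p x) =ᶠ[nhds t] fun s : ℝ => f (x * s) := by
        have : ∀ᶠ s : ℝ in nhds t, ‖x * (s : ℂ)‖ < 1 :=
          (hlin.continuousAt.norm.tendsto).eventually_lt_const ht
        filter_upwards [this] with s hs using hft s hs
      rw [hev.deriv_eq, hcomp.deriv]
      ring

/-- Termwise application of `D = t d/dt` to the binomial series. -/
theorem hasSum_degreeOp_rootFun {p : ℕ} (hp : 1 ≤ p) {x : ℂ} (k : ℕ) {t : ℝ} (ht : ‖x * t‖ < 1) :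
    HasSum (fun n => taylorCoeff p n * (n : ℂ) ^ k * (x * t) ^ n)
      (degreeOp^[k] (rootFun p x) t) := by
  obtain ⟨f, hf, hft⟩ := exists_hasSum_eulerSeries hp x k
  rw [hft t ht]
  exact hf _ ht

theorem contDiffAt_rootFun (p : ℕ) {x : ℂ} {t : ℝ} (h : x * t ≠ 1) :
    ContDiffAt ℝ ∞ (rootFun p x) t := by
  have hlin : ContDiff ℝ ∞ (fun s : ℝ => 1 - x * (s : ℂ)) :=
    contDiff_const.sub (contDiff_const.mul Complex.ofRealCLM.contDiff)
  have hs : ∀ z ∈ Complex.slitPlane, ContDiffAt ℝ ∞ (fun w : ℂ => w ^ ((1 : ℂ) / p)) z := by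
    intro z hz
    have : AnalyticAt ℂ (fun w : ℂ => w ^ ((1 : ℂ) / p)) z :=
      analyticAt_id.cpow analyticAt_const hz
    exact this.contDiffAt.restrict_scalars ℝ
  by_cases hsp : 1 - x * (t : ℂ) ∈ Complex.slitPlane
  · exact (hs _ hsp).comp t hlin.contDiffAt
  · -- on the branch cut `x` is real, so the whole line stays on the cut near `t`
    rw [Complex.mem_slitPlane_iff, not_or, not_lt, not_not] at hsp
    have hre : (1 - x * (t : ℂ)).re = 1 - x.re * t := by simp
    have him : (1 - x * (t : ℂ)).im = -(x.im * t) := by simp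
    rw [hre, him] at hsp
    have ht : t ≠ 0 := by rintro rfl; norm_num at hsp
    have hx : x = (x.re : ℂ) := by
      refine Complex.ext rfl ?_
      rcases mul_eq_zero.1 (neg_eq_zero.1 hsp.2) with h | h
      · simpa using h
      · exact absurd h ht
    have hlt : 1 - x.re * t < 0 := by
      refine lt_of_le_of_ne hsp.1 fun h0 => h ?_
      rw [hx]
      exact_mod_cast (sub_eq_zero.1 h0).symm
    -- On the cut the principal argument is `π`, so a constant phase splits off a power of a
    -- positive real.
    have hev : rootFun p x =ᶠ[nhds t] fun s : ℝ =>
        (x * (s : ℂ) - 1) ^ ((1 : ℂ) / p) * Complex.exp (Real.pi * Complex.I * ((1 : ℂ) / p)) := by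
      have : ∀ᶠ s : ℝ in nhds t, 1 - x.re * s < 0 :=
        (Continuous.tendsto (by fun_prop : Continuous fun s : ℝ => 1 - x.re * s) t
          ).eventually_lt_const hlt
      filter_upwards [this] with s hs
      have h1 : 1 - x * (s : ℂ) = ((1 - x.re * s : ℝ) : ℂ) := by rw [hx]; push_cast; simp
      rw [rootFun, h1, Complex.ofReal_cpow_of_nonpos hs.le]
      congr 2
      rw [← h1]; ring
    refine ContDiffAt.congr_of_eventuallyEq ?_ hev
    refine ContDiffAt.mul ?_ contDiffAt_const
    have hmem : x * (t : ℂ) - 1 ∈ Complex.slitPlane := by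
      rw [Complex.mem_slitPlane_iff]
      left
      simp; linarith
    have hlin' : ContDiff ℝ ∞ (fun s : ℝ => x * (s : ℂ) - 1) :=
      (contDiff_const.mul Complex.ofRealCLM.contDiff).sub contDiff_const
    exact ContDiffAt.comp (g := fun w : ℂ => w ^ ((1 : ℂ) / p)) t (hs _ hmem) hlin'.contDiffAt

/-! ### Uniqueness of roots with spectrum in a sector -/

theorem eq_of_pow_eq_pow_of_abs_arg_lt {p : ℕ} (hp : p ≠ 0) {x y : ℂ} (hx : |x.arg| < Real.pi / p)
    (hy : |y.arg| < Real.pi / p) (h : x ^ p = y ^ p) : x = y := by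
  rw [abs_lt] at hx hy
  rw [← Complex.pow_cpow_nat_inv hp hx.1 hx.2.le, h,
    Complex.pow_cpow_nat_inv hp hy.1 hy.2.le]

/-- Two `p`-th roots of the same element, one a polynomial in the other, with spectra in the open
sector `|arg z| < π / p`, coincide. -/
theorem aeval_eq_self_of_pow_eq {𝒜 : Type*} [Ring 𝒜] [Algebra ℂ 𝒜] {p : ℕ} (hp : p ≠ 0)
    {x : 𝒜} (hne : (spectrum ℂ x).Nonempty) (q : ℂ[X]) (hpow : x ^ p = aeval x q ^ p)
    (hx : ∀ z ∈ spectrum ℂ x, z ≠ 0 ∧ |z.arg| < Real.pi / p)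
    (hq : ∀ z ∈ spectrum ℂ (aeval x q), |z.arg| < Real.pi / p) : aeval x q = x := by
  have : Nontrivial 𝒜 := by
    by_contra h
    rw [not_nontrivial_iff_subsingleton] at h
    rw [spectrum.of_subsingleton] at hne
    exact Set.not_nonempty_empty hne
  set g : ℂ[X] := ∑ i ∈ Finset.range p, X ^ i * q ^ (p - 1 - i) with hg
  have hfac : (X - q) * g = X ^ p - q ^ p := (Commute.all X q).mul_geom_sum₂ p
  have hzero : aeval x (X ^ p - q ^ p) = 0 := by simp [hpow]
  -- At an eigenvalue `z` of `x`, the numbers `z` and `q(z)` have equal `p`-th powers and lie in the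
  -- sector, so they agree and `g(z) = p z ^ (p - 1) ≠ 0`.
  have hunit : IsUnit (aeval x g) := by
    by_contra hu
    rw [← spectrum.zero_mem_iff ℂ, spectrum.map_polynomial_aeval_of_nonempty x g hne] at hu
    obtain ⟨z, hz, hz0⟩ := hu
    have h1 : eval z (X ^ p - q ^ p) ∈ spectrum ℂ (aeval x (X ^ p - q ^ p)) :=
      spectrum.subset_polynomial_aeval x _ ⟨z, hz, rfl⟩
    rw [hzero, spectrum.zero_eq, Set.mem_singleton_iff, eval_sub, eval_pow, eval_pow, eval_X,
      sub_eq_zero] at h1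
    have h2 := eq_of_pow_eq_pow_of_abs_arg_lt hp (hx z hz).2
      (hq _ (spectrum.subset_polynomial_aeval x q ⟨z, hz, rfl⟩)) h1
    simp only [hg, eval_finsetSum, eval_mul, eval_pow, eval_X, ← h2] at hz0
    rw [Finset.sum_congr rfl (g := fun _ => z ^ (p - 1)) fun i hi => by
      rw [Finset.mem_range] at hi
      rw [← pow_add]; congr 1; omega] at hz0
    rw [Finset.sum_const, Finset.card_range, nsmul_eq_mul] at hz0
    exact mul_ne_zero (Nat.cast_ne_zero.2 hp) (pow_ne_zero _ (hx z hz).1) hz0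
  rw [← hfac, map_mul, hunit.mul_left_eq_zero, map_sub, aeval_X, sub_eq_zero] at hzero
  exact hzero.symm

/-! ### Products of convergent series in a finite-dimensional algebra -/

section PowerSeries

variable {𝒜 : Type*} [NormedRing 𝒜] [NormedAlgebra ℂ 𝒜] [FiniteDimensional ℂ 𝒜]

/-- In finite dimension summability is absolute, so Cauchy products are available. -/
theorem hasSum_coeff_mul_smul_pow {B B' : PowerSeries ℂ} {a F F' : 𝒜}
    (h : HasSum (fun n => PowerSeries.coeff n B • a ^ n) F)
    (h' : HasSum (fun n => PowerSeries.coeff n B' • a ^ n) F') :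
    HasSum (fun n => PowerSeries.coeff n (B * B') • a ^ n) (F * F') := by
  have : CompleteSpace 𝒜 := FiniteDimensional.complete ℂ 𝒜
  have : FiniteDimensional ℝ 𝒜 := FiniteDimensional.complexToReal 𝒜
  have hs : Summable fun n => ‖PowerSeries.coeff n B • a ^ n‖ := h.summable.norm
  have hs' : Summable fun n => ‖PowerSeries.coeff n B' • a ^ n‖ := h'.summable.norm
  have key := hasSum_sum_range_mul_of_summable_norm hs hs'
  rw [h.tsum_eq, h'.tsum_eq] at key
  refine key.congr_fun fun n => ?_
  rw [PowerSeries.coeff_mul, Finset.Nat.sum_antidiagonal_eq_sum_range_succ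
    (fun i j => PowerSeries.coeff i B * PowerSeries.coeff j B'), Finset.sum_smul]
  refine Finset.sum_congr rfl fun k hk => ?_
  rw [Finset.mem_range] at hk
  rw [smul_mul_assoc, mul_smul_comm, smul_smul, ← pow_add, Nat.add_sub_cancel' (by omega)]

theorem hasSum_coeff_pow_smul_pow {B : PowerSeries ℂ} {a F : 𝒜}
    (h : HasSum (fun n => PowerSeries.coeff n B • a ^ n) F) (k : ℕ) :
    HasSum (fun n => PowerSeries.coeff n (B ^ k) • a ^ n) (F ^ k) := by
  induction k with
  | zero =>
    rw [pow_zero, pow_zero]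
    convert hasSum_single (f := fun n => PowerSeries.coeff n (1 : PowerSeries ℂ) • a ^ n) 0 ?_
    · simp
    · intro n hn
      simp [PowerSeries.coeff_one, hn]
  | succ k ih =>
    rw [pow_succ, pow_succ]
    exact hasSum_coeff_mul_smul_pow ih h

theorem pow_eq_one_sub_of_hasSum {p : ℕ} (hp : p ≠ 0) {a F : 𝒜}
    (h : HasSum (fun n => taylorCoeff p n • a ^ n) F) : F ^ p = 1 - a := by
  have h1 := hasSum_coeff_pow_smul_pow (B := rootSeries p) (a := a) (F := F)
    (by simpa [rootSeries] using h) p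
  rw [rootSeries_pow hp] at h1
  have h2 := hasSum_sum_of_ne_finset_zero
    (f := fun n => PowerSeries.coeff n (1 - PowerSeries.X : PowerSeries ℂ) • a ^ n)
    (L := SummationFilter.unconditional ℕ) (s := Finset.range 2) (fun n hn => by
      rw [Finset.mem_range, not_lt] at hn
      have h0 : n ≠ 0 := by omega
      have h1 : n ≠ 1 := by omega
      simp [PowerSeries.coeff_one, PowerSeries.coeff_X, h0, h1])
  rw [h1.unique h2]
  simp [Finset.sum_range_succ, PowerSeries.coeff_one, PowerSeries.coeff_X, sub_eq_add_neg]

end PowerSeries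

/-! ### The Fibonacci–Hörner decomposition of the principal root -/

variable {P : ℂ[X]} {m : ℕ} {μ lam : ℂ}

theorem hasSum_sum_phi_smul {𝒜 : Type*} [Ring 𝒜] [Algebra ℂ 𝒜] [TopologicalSpace 𝒜]
    [ContinuousAdd 𝒜] [ContinuousSMul ℂ 𝒜] {p : ℕ} (hp : 1 ≤ p)
    (hP : P = (X - C μ) * (X - C lam) ^ m) (hm : 1 ≤ m) (hμ : μ ≠ 0) (hlam : lam ≠ 0)
    (hne : μ ≠ lam) {a : 𝒜} (ha : aeval a P = 0) {t : ℝ}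
    (ht : ∀ z ∈ spectrum ℂ a, ‖z * t‖ < 1) :
    HasSum (fun n => (taylorCoeff p n * (t : ℂ) ^ n) • a ^ n)
      (∑ s ∈ Finset.range (m + 1), phi p (m + 1) μ lam s t • aeval a (hornerPoly P s)) := by
  rw [sum_phi_smul]
  have h1 : HasSum (fun n => (taylorCoeff p n * (μ * t) ^ n) • simpleComponent P m μ lam a)
      (rootFun p μ t • simpleComponent P m μ lam a) := by
    by_cases hs : μ ∈ spectrum ℂ a
    · exact (hasSum_taylorCoeff p (ht μ hs)).smul_const _
    · simp [simpleComponent_eq_zero hP hμ ha hs]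
  have h2 : ∀ k ∈ Finset.range m, HasSum (fun n => (taylorCoeff p n * (n : ℂ) ^ k *
      (lam * t) ^ n) • multipleComponent P m μ lam a k)
      (degreeOp^[k] (rootFun p lam) t • multipleComponent P m μ lam a k) := by
    intro k hk
    by_cases hs : lam ∈ spectrum ℂ a
    · exact (hasSum_degreeOp_rootFun hp k (ht lam hs)).smul_const _
    · simp [multipleComponent_eq_zero hP hm hμ hlam hne ha hs (Finset.mem_range.1 hk)]
  refine (h1.add (hasSum_sum h2)).congr_fun fun n => ?_
  rw [pow_eq_components hP hm hμ hlam hne ha n, smul_add, Finset.smul_sum, smul_smul]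
  congr 1
  · rw [mul_pow]; congr 1; ring
  · refine Finset.sum_congr rfl fun k _ => ?_
    rw [smul_smul, mul_pow]; congr 1; ring

/-! ### Eigenvalues of the sum. -/

theorem one_sub_cpow_mem_sector {p : ℕ} (hp : 1 ≤ p) {z : ℂ} (hz : ‖z‖ < 1) :
    (1 - z) ^ ((1 : ℂ) / p) ≠ 0 ∧ |((1 - z) ^ ((1 : ℂ) / p)).arg| < Real.pi / p := by
  have hp' : (1 : ℝ) ≤ p := by exact_mod_cast hp
  have hre : 0 < (1 - z).re := by
    have := (Complex.re_le_norm z).trans_lt hz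
    simp; linarith
  have h0 : 1 - z ≠ 0 := by rintro h; rw [h] at hre; simp at hre
  have harg : |(1 - z).arg| < Real.pi / 2 := Complex.abs_arg_lt_pi_div_two_iff.2 (Or.inl hre)
  refine ⟨by simp [Complex.cpow_eq_zero_iff, h0], ?_⟩
  have him : (Complex.log (1 - z) * ((1 : ℂ) / p)).im = (1 - z).arg / p := by
    rw [show (1 : ℂ) / p = ((1 / p : ℝ) : ℂ) by push_cast; rfl, Complex.im_mul_ofReal,
      Complex.log_im]
    ring
  have habs : |(1 - z).arg / p| < Real.pi / p := by
    rw [abs_div, abs_of_pos (by linarith : (0 : ℝ) < p)]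
    gcongr
    linarith [Real.pi_pos]
  have hle : Real.pi / p ≤ Real.pi := div_le_self Real.pi_pos.le hp'
  rw [abs_lt] at habs
  rw [Complex.cpow_def_of_ne_zero h0, ← Complex.log_im, Complex.log_exp, him, abs_lt]
  · exact habs
  · rw [him]; linarith
  · rw [him]; linarith

theorem eval_eq_zero_of_mem_spectrum {𝒜 : Type*} [Ring 𝒜] [Algebra ℂ 𝒜] {a : 𝒜} {Q : ℂ[X]}
    (ha : aeval a Q = 0) {z : ℂ} (hz : z ∈ spectrum ℂ a) : eval z Q = 0 := by
  have : Nontrivial 𝒜 := by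
    by_contra h
    rw [not_nontrivial_iff_subsingleton] at h
    rw [spectrum.of_subsingleton] at hz
    exact hz
  have h := spectrum.subset_polynomial_aeval a Q ⟨z, hz, rfl⟩
  rwa [ha, spectrum.zero_eq] at h

/-- Both sides sum the same series, by the decomposition applied in the algebra `ℂ` to the root `z`
of `P`. -/
theorem eval_sum_phi {p : ℕ} (hp : 1 ≤ p) (hP : P = (X - C μ) * (X - C lam) ^ m) (hm : 1 ≤ m)
    (hμ : μ ≠ 0) (hlam : lam ≠ 0) (hne : μ ≠ lam) {z : ℂ} (hz : eval z P = 0) {t : ℝ}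
    (ht : ‖z * t‖ < 1) :
    eval z (∑ s ∈ Finset.range (m + 1), C (phi p (m + 1) μ lam s t) * hornerPoly P s) =
      (1 - z * t) ^ ((1 : ℂ) / p) := by
  have h := hasSum_sum_phi_smul (𝒜 := ℂ) hp hP hm hμ hlam hne (a := z) (t := t)
    (by rwa [coe_aeval_eq_eval]) (fun w hw => by
      rw [← Algebra.algebraMap_self_apply z, spectrum.scalar_eq, Set.mem_singleton_iff] at hw
      rwa [hw])
  have h' : HasSum (fun n => (taylorCoeff p n * (t : ℂ) ^ n) • z ^ n)
      ((1 - z * t) ^ ((1 : ℂ) / p)) := by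
    refine (hasSum_taylorCoeff p ht).congr_fun fun n => ?_
    rw [smul_eq_mul, mul_pow]; ring
  rw [← h.unique h']
  simp [eval_finsetSum, coe_aeval_eq_eval]

theorem norm_mul_lt_one_of_mem_spectrum {𝒜 : Type*} [Ring 𝒜] [Algebra ℂ 𝒜] {a : 𝒜} {t : ℝ}
    (h : ‖t‖ₑ * spectralRadius ℂ a < 1) {z : ℂ} (hz : z ∈ spectrum ℂ a) : ‖z * t‖ < 1 := by
  have h1 : ‖z‖ₑ ≤ spectralRadius ℂ a := le_iSup₂ (f := fun k _ => (‖k‖₊ : ENNReal)) z hz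
  have h2 : ‖t‖ₑ * ‖z‖ₑ < 1 := (mul_le_mul_right h1 _).trans_lt h
  have h3 : ‖z * (t : ℂ)‖ₑ < 1 := by
    rw [enorm_mul, mul_comm]
    simpa [enorm_eq_nnnorm] using h2
  rw [enorm_eq_nnnorm] at h3
  exact_mod_cast h3

theorem isPrincipalRoot_sum_phi {d : ℕ} {p : ℕ} (hp : 1 ≤ p)
    (hP : P = (X - C μ) * (X - C lam) ^ m) (hm : 1 ≤ m) (hμ : μ ≠ 0) (hlam : lam ≠ 0)
    (hne : μ ≠ lam) {A : Matrix (Fin d) (Fin d) ℂ} (hA : aeval A P = 0) {t : ℝ}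
    (ht : ∀ z ∈ spectrum ℂ A, ‖z * t‖ < 1) :
    IsPrincipalRoot p (1 - (t : ℂ) • A)
      (∑ s ∈ Finset.range (m + 1), phi p (m + 1) μ lam s t • hornerMatrix P A s) := by
  constructor
  · let _ : NormedRing (Matrix (Fin d) (Fin d) ℂ) := Matrix.linftyOpNormedRing
    let _ : NormedAlgebra ℂ (Matrix (Fin d) (Fin d) ℂ) := Matrix.linftyOpNormedAlgebra
    refine pow_eq_one_sub_of_hasSum (by omega) ?_
    refine (hasSum_sum_phi_smul hp hP hm hμ hlam hne hA ht).congr_fun fun n => ?_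
    rw [_root_.smul_pow, smul_smul]
  · intro z hz
    have hF : ∑ s ∈ Finset.range (m + 1), phi p (m + 1) μ lam s t • hornerMatrix P A s =
        aeval A (∑ s ∈ Finset.range (m + 1), C (phi p (m + 1) μ lam s t) * hornerPoly P s) := by
      simp [hornerMatrix, Algebra.smul_def]
    -- The spectral mapping theorem used below needs a nonempty spectrum, which fails for `d = 0`.
    rcases isEmpty_or_nonempty (Fin d) with hd | hd
    · rw [spectrum.of_subsingleton] at hz
      exact absurd hz (Set.notMem_empty z)
    rw [hF, spectrum.map_polynomial_aeval_of_nonempty A _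
      (spectrum.nonempty_of_isAlgClosed_of_finiteDimensional ℂ A)] at hz
    obtain ⟨w, hw, rfl⟩ := hz
    dsimp only
    rw [eval_sum_phi hp hP hm hμ hlam hne (eval_eq_zero_of_mem_spectrum hA hw) (ht w hw)]
    exact one_sub_cpow_mem_sector hp (ht w hw)

/-- A principal root of `1 - t A` which is a polynomial in `A` is the only principal root. -/
theorem IsPrincipalRoot.eq_aeval {d p : ℕ} (hp : p ≠ 0) {A Y : Matrix (Fin d) (Fin d) ℂ} {t : ℂ}
    (ht : t ≠ 0) {Q : ℂ[X]} (hQ : IsPrincipalRoot p (1 - t • A) (aeval A Q))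
    (hY : IsPrincipalRoot p (1 - t • A) Y) : Y = aeval A Q := by
  rcases isEmpty_or_nonempty (Fin d) with hd | hd
  · exact Subsingleton.elim _ _
  -- Solving `Y ^ p = 1 - t A` for `A` is where `t ≠ 0` enters.
  have hAY : A = aeval Y (C t⁻¹ * (1 - X ^ p)) := by
    simp only [map_mul, map_sub, map_one, map_pow, aeval_X, aeval_C]
    rw [hY.1, sub_sub_cancel, ← Algebra.smul_def, smul_smul, inv_mul_cancel₀ ht, one_smul]
  have hQY : aeval A Q = aeval Y (Q.comp (C t⁻¹ * (1 - X ^ p))) := by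
    rw [aeval_comp, ← hAY]
  rw [hQY] at hQ ⊢
  exact (aeval_eq_self_of_pow_eq hp (spectrum.nonempty_of_isAlgClosed_of_finiteDimensional ℂ Y) _
    (hY.1.trans hQ.1.symm) hY.2 fun z hz => (hQ.2 z hz).2).symm

end MatrixRoot

theorem proposition3p5 {d : ℕ} (A : Matrix (Fin d) (Fin d) ℂ) (p r : ℕ) (hp : 2 ≤ p) (hr : 2 ≤ r)
    (μ lam : ℂ) (hμ : μ ≠ 0) (hlam : lam ≠ 0) (hne : μ ≠ lam)
    (P : Polynomial ℂ)
    (hP : P = (Polynomial.X - Polynomial.C μ) * (Polynomial.X - Polynomial.C lam) ^ (r - 1))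
    (hA : Polynomial.aeval A P = 0)
    (t : ℝ) (ht : t ≠ 0) (htA : ‖t‖ₑ * spectralRadius ℂ A < 1) :
    (∀ X : Matrix (Fin d) (Fin d) ℂ,
      MatrixRoot.IsPrincipalRoot p (1 - (t : ℂ) • A) X ↔
        X = ∑ s ∈ Finset.range r, MatrixRoot.phi p r μ lam s t • MatrixRoot.hornerMatrix P A s) ∧
    HasSum (fun n : ℕ => (MatrixRoot.taylorCoeff p n * (t : ℂ) ^ n) • A ^ n)
      (∑ s ∈ Finset.range r, MatrixRoot.phi p r μ lam s t • MatrixRoot.hornerMatrix P A s) ∧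
    (lam * (t : ℂ) ≠ 1 → ContDiffAt ℝ ∞ (MatrixRoot.rootFun p lam) t) := by
  obtain ⟨m, rfl⟩ : ∃ m, r = m + 1 := ⟨r - 1, by omega⟩
  rw [Nat.add_sub_cancel] at hP
  have hm : 1 ≤ m := by omega
  have hp1 : 1 ≤ p := by omega
  have hspec := fun z (hz : z ∈ spectrum ℂ A) =>
    MatrixRoot.norm_mul_lt_one_of_mem_spectrum htA hz
  have hroot := MatrixRoot.isPrincipalRoot_sum_phi hp1 hP hm hμ hlam hne hA hspec
  refine ⟨fun Y => ⟨fun hY => ?_, fun hY => hY ▸ hroot⟩,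
    MatrixRoot.hasSum_sum_phi_smul hp1 hP hm hμ hlam hne hA hspec,
    fun h => MatrixRoot.contDiffAt_rootFun p h⟩
  have hF : ∑ s ∈ Finset.range (m + 1), MatrixRoot.phi p (m + 1) μ lam s t •
      MatrixRoot.hornerMatrix P A s = aeval A (∑ s ∈ Finset.range (m + 1),
        C (MatrixRoot.phi p (m + 1) μ lam s t) * MatrixRoot.hornerPoly P s) := by
    simp [MatrixRoot.hornerMatrix, Algebra.smul_def]
  rw [hF] at hroot ⊢
  exact hroot.eq_aeval (by omega) (Complex.ofReal_ne_zero.2 ht) hY
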